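/- Let $m,d\ge 0$ be integers. Let $\Omega=\{\omega\in C(\mathbb R,\mathbb R^d):\omega(0)=0\}$ carry the compact-open topology and its Borel $\sigma$-algebra, and let $\mathbb P$ be the (two-sided, standard) Wiener measure on $\Omega$, i.e. the Borel probability measure under which the coordinate process $W_t(\omega)=\omega(t)$, $t\in\mathbb R$, has independent increments and $W_t-W_s$ has law $N(0,(t-s)I_d)$ for all real $s\le t$. For $t\in\mathbb R$ let $\Phi_t:\Omega\to\Omega$, $(\Phi_t\omega)(s)=\omega(t+s)-\omega(t)$, be the Wiener shift. Let $\mathbb T^m=(\mathbb R/\mathbb Z)^m$ with its normalized Haar (Lebesgue) measure, and let $\alpha\in\mathbb R^m$ be a non-resonant rotation vector: $k\cdot\alpha\notin\mathbb Z$ for every $k\in\mathbb Z^m\setminus\{0\}$. Then the map $$T_{\alpha,\Phi_1}(\theta,\omega)=(\theta+\alpha,\Phi_1\omega)$$ on $\mathbb T^m\times\Omega$ is measure-preserving and ergodic with respect to the product of the Haar measure on $\mathbb T^m$ and $\mathbb P$. -/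

import Mathlib

open MeasureTheory ProbabilityTheory

/-- The canonical path space of two-sided paths `ω : ℝ → ℝ^d` that are continuous
and satisfy `ω 0 = 0`. -/
def WienerSpace (d : ℕ) : Type :=
  {ω : C(ℝ, EuclideanSpace ℝ (Fin d)) // ω 0 = 0}

namespace WienerSpace

/-- The compact-open topology (uniform convergence on compact sets). -/
instance instTopologicalSpace (d : ℕ) : TopologicalSpace (WienerSpace d) :=
  inferInstanceAs (TopologicalSpace {ω : C(ℝ, EuclideanSpace ℝ (Fin d)) // ω 0 = 0})

/-- The Borel sigma-algebra of the compact-open topology. -/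
instance instMeasurableSpace (d : ℕ) : MeasurableSpace (WienerSpace d) :=
  borel (WienerSpace d)

instance instBorelSpace (d : ℕ) : BorelSpace (WienerSpace d) := ⟨rfl⟩

/-- The coordinate process `W_t(ω) = ω(t)`. -/
def coord {d : ℕ} (t : ℝ) (ω : WienerSpace d) : EuclideanSpace ℝ (Fin d) := ω.1 t

/-- The Wiener shift `(Φ_t ω)(s) = ω(t + s) - ω(t)`. -/
def shift {d : ℕ} (t : ℝ) (ω : WienerSpace d) : WienerSpace d :=
  ⟨⟨fun s => ω.1 (t + s) - ω.1 t, by fun_prop⟩, by simp⟩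

/-- `P` is the (two-sided, standard, `d`-dimensional) Wiener measure: the law on path space under
which the coordinate process, which is continuous and starts from `0`, has independent increments
and `W_t - W_s` has law `N(0, (t - s) I_d)` for all real `s ≤ t`. These conditions determine the
finite-dimensional distributions and hence determine `P`. -/
structure IsWienerMeasure {d : ℕ} (P : Measure (WienerSpace d)) : Prop where
  isProbabilityMeasure : IsProbabilityMeasure P
  hasIndepIncrements : HasIndepIncrements (fun (t : ℝ) (ω : WienerSpace d) => coord t ω) P
  map_increment : ∀ s t : ℝ, s ≤ t →
    P.map (fun ω => coord t ω - coord s ω) =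
      (stdGaussian (EuclideanSpace ℝ (Fin d))).map (fun x => Real.sqrt (t - s) • x)

end WienerSpace

/-- `1, α_1, …, α_m` are rationally independent: `k · α` is not an integer for any nonzero
integer vector `k`. -/
def IsNonresonant {m : ℕ} (α : Fin m → ℝ) : Prop :=
  ∀ k : Fin m → ℤ, k ≠ 0 → ∀ n : ℤ, ∑ i, (k i : ℝ) * α i ≠ (n : ℝ)

/-- The product map `(θ, ω) ↦ (θ + α mod 1, Φ_1 ω)` on `𝕋^m × Ω`, with `𝕋 = ℝ/ℤ`. -/
def rotationShift {m d : ℕ} (α : Fin m → ℝ)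
    (p : UnitAddTorus (Fin m) × WienerSpace d) : UnitAddTorus (Fin m) × WienerSpace d :=
  (p.1 + fun i => (α i : UnitAddCircle), WienerSpace.shift 1 p.2)

/-! The noise is mixing and the rotation is ergodic. Let `S` be invariant, of measure `c`. Its
section measures `θ ↦ P(S_θ)` form a rotation-invariant function, constant by Fourier analysis, so
a.e. equal to `c` (`measureReal_section_ae_eq`). Approximate `S` by a set `S'` depending on `θ` and
on finitely many dyadic increments, and let `q θ` be its section measure. For a suitable `n` the
increments seen by `S'` and by its `n`-th preimage are disjoint, so given `θ` the two events are
independent and their intersection has measure `∫ q(θ) q(θ + nα)`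
(`exists_measureReal_inter_preimage_iterate`). As `q` is `L¹`-close to `c`, this is close to `c²`;
by invariance of `S` it is also close to `c`. Hence `c = c²` (`abs_measureReal_sub_sq_le`). -/

/-- A map into `C(X, Y)` is Borel measurable as soon as all its evaluations are. -/
theorem ContinuousMap.measurable_of_eval {Z X Y : Type*} [MeasurableSpace Z]
    [PseudoEMetricSpace X] [SecondCountableTopology X] [LocallyCompactSpace X]
    [EMetricSpace Y] [SecondCountableTopology Y] [MeasurableSpace Y] [BorelSpace Y]
    {f : Z → C(X, Y)} (hf : ∀ x, Measurable fun z => f z x) :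
    Measurable[_, borel C(X, Y)] f := by
  rw [borel_eq_generateFrom_of_subbasis (ContinuousMap.compactOpen_eq (X := X) (Y := Y))]
  refine measurable_generateFrom ?_
  rintro _ ⟨K, hK, U, hU, rfl⟩
  obtain ⟨D, hDK, hD, hKD⟩ := (TopologicalSpace.IsSeparable.of_separableSpace K).exists_countable_dense_subset
  -- By compactness, `f z` maps `K` into `U` iff its image keeps a positive distance from `Uᶜ`; such
  -- a bound is a closed condition, so a countable dense subset of `K` tests it.
  have key : f ⁻¹' {g : C(X, Y) | Set.MapsTo g K U} =
      ⋃ n : ℕ, ⋂ x ∈ D, {z | ((n : ENNReal) + 1)⁻¹ ≤ Metric.infEDist (f z x) Uᶜ} := by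
    ext z
    simp only [Set.mem_preimage, Set.mem_ofPred_eq, Set.mem_iUnion, Set.mem_iInter]
    constructor
    · intro hz
      obtain ⟨r, hr, hrs⟩ := Metric.exists_pos_forall_lt_edist
        (hK.image (f z).continuous) hU.isClosed_compl
        (Set.disjoint_compl_right_iff_subset.2 hz.image_subset)
      obtain ⟨n, hn⟩ := ENNReal.exists_inv_nat_lt (ENNReal.coe_ne_zero.2 hr.ne')
      refine ⟨n, fun x hx => Metric.le_infEDist.2 fun y hy => ?_⟩
      refine le_trans ?_ (hrs _ ⟨x, hDK hx, rfl⟩ y hy).le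
      exact (ENNReal.inv_le_inv.2 le_self_add).trans hn.le
    · rintro ⟨n, hn⟩ x hx
      by_contra hxU
      have hclosed : IsClosed {x | ((n : ENNReal) + 1)⁻¹ ≤ Metric.infEDist (f z x) Uᶜ} :=
        isClosed_le continuous_const (Metric.continuous_infEDist.comp (f z).continuous)
      have := closure_minimal (t := {x | ((n : ENNReal) + 1)⁻¹ ≤ Metric.infEDist (f z x) Uᶜ})
        (fun y hy => hn y hy) hclosed (hKD hx)
      simp only [Set.mem_ofPred_eq, Metric.infEDist_zero_of_mem (s := Uᶜ) hxU, nonpos_iff_eq_zero,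
        ENNReal.inv_eq_zero] at this
      exact absurd this (by finiteness)
  rw [key]
  refine MeasurableSet.iUnion fun n => MeasurableSet.biInter hD fun x _ => ?_
  exact measurableSet_le measurable_const (Metric.continuous_infEDist.measurable.comp (hf x))

/-! ### Paths, shifts and dyadic increments -/

namespace WienerSpace

variable {d : ℕ}

theorem continuous_coord (t : ℝ) : Continuous (coord t : WienerSpace d → _) :=
  (continuous_eval_const t).comp continuous_subtype_val

theorem measurable_coord (t : ℝ) : Measurable (coord t : WienerSpace d → _) :=
  (continuous_coord t).measurable

theorem continuous_path (ω : WienerSpace d) : Continuous fun t => coord t ω :=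
  ω.1.continuous

@[simp]
theorem coord_zero (ω : WienerSpace d) : coord 0 ω = 0 := ω.2

theorem coord_shift (s t : ℝ) (ω : WienerSpace d) :
    coord s (shift t ω) = coord (t + s) ω - coord t ω := rfl

theorem measurable_of_coord {Z : Type*} [MeasurableSpace Z] {f : Z → WienerSpace d}
    (hf : ∀ t, Measurable fun z => coord t (f z)) : Measurable f := by
  have hborel : instMeasurableSpace d =
      (borel C(ℝ, EuclideanSpace ℝ (Fin d))).comap Subtype.val := borel_comap
  rw [hborel]
  exact measurable_comap_iff.2 (ContinuousMap.measurable_of_eval hf)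

theorem measurable_shift (t : ℝ) : Measurable (shift t : WienerSpace d → _) :=
  measurable_of_coord fun s => (measurable_coord (t + s)).sub (measurable_coord t)

theorem iterate_shift_one (n : ℕ) : (shift 1 : WienerSpace d → _)^[n] = shift (n : ℝ) := by
  induction n with
  | zero =>
    ext ω : 1
    refine Subtype.ext (ContinuousMap.ext fun s => ?_)
    change coord s ω = coord s (shift (0 : ℕ) ω)
    simp [coord_shift]
  | succ n ih =>
    ext ω : 1
    refine Subtype.ext (ContinuousMap.ext fun s => ?_)
    rw [Function.iterate_succ', Function.comp_apply, ih]
    change coord s (shift 1 (shift n ω)) = coord s (shift (n + 1 : ℕ) ω)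
    simp only [coord_shift, Nat.cast_add, Nat.cast_one]
    rw [add_assoc]
    abel

/-- The points of the dyadic grid of mesh `2⁻ʲ` starting from `-2ʲ`. -/
noncomputable def gridTime (j i : ℕ) : ℝ := i / 2 ^ j - 2 ^ j

theorem monotone_gridTime (j : ℕ) : Monotone (gridTime j) := fun a b h => by
  unfold gridTime; gcongr

theorem gridTime_succ_sub (j i : ℕ) : gridTime j (i + 1) - gridTime j i = 1 / 2 ^ j := by
  unfold gridTime; push_cast; ring

theorem gridTime_add (j i n : ℕ) : gridTime j (i + n * 2 ^ j) = n + gridTime j i := by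
  unfold gridTime; push_cast; field_simp; ring

theorem gridTime_center (j : ℕ) : gridTime j (4 ^ j) = 0 := by
  have : (4 : ℝ) ^ j = 2 ^ j * 2 ^ j := by rw [← mul_pow]; norm_num
  unfold gridTime; push_cast; rw [this]; field_simp; simp

/-- The finer grid starts `2 ^ j` earlier, which is `2 * 4 ^ j` of its cells. -/
theorem gridTime_refine (j i : ℕ) :
    gridTime (j + 1) (2 * i + 2 * 4 ^ j) = gridTime j i := by
  have : (4 : ℝ) ^ j = 2 ^ j * 2 ^ j := by rw [← mul_pow]; norm_num
  unfold gridTime; push_cast; rw [this, pow_succ]; field_simp; ring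

/-- The increments of a path along the dyadic grid. -/
noncomputable def gridIncr (j i : ℕ) (ω : WienerSpace d) : EuclideanSpace ℝ (Fin d) :=
  coord (gridTime j (i + 1)) ω - coord (gridTime j i) ω

theorem measurable_gridIncr (j i : ℕ) : Measurable (gridIncr j i : WienerSpace d → _) :=
  (measurable_coord _).sub (measurable_coord _)

theorem gridIncr_refine (j i : ℕ) (ω : WienerSpace d) :
    gridIncr j i ω =
      gridIncr (j + 1) (2 * i + 2 * 4 ^ j) ω + gridIncr (j + 1) (2 * i + 2 * 4 ^ j + 1) ω := by
  have h1 := gridTime_refine j i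
  have h2 := gridTime_refine j (i + 1)
  rw [show 2 * (i + 1) + 2 * 4 ^ j = 2 * i + 2 * 4 ^ j + 1 + 1 by ring] at h2
  simp only [gridIncr, ← h1, ← h2]
  abel

theorem gridIncr_shift (j i n : ℕ) (ω : WienerSpace d) :
    gridIncr j i (shift n ω) = gridIncr j (i + n * 2 ^ j) ω := by
  simp only [gridIncr, coord_shift]
  rw [show i + n * 2 ^ j + 1 = i + 1 + n * 2 ^ j by ring, gridTime_add, gridTime_add]
  abel

/-- A path-valued map is measurable if all its increments along the dyadic grids are. -/
theorem measurable_of_gridIncr {Z : Type*} [MeasurableSpace Z] {f : Z → WienerSpace d}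
    (hf : ∀ j, ∀ i < 2 * 4 ^ j, Measurable fun z => gridIncr j i (f z)) : Measurable f := by
  have hdiff (j a : ℕ) (ha : a ≤ 2 * 4 ^ j) :
      Measurable fun z => coord (gridTime j a) (f z) - coord (gridTime j 0) (f z) := by
    have : (fun z => coord (gridTime j a) (f z) - coord (gridTime j 0) (f z)) =
        fun z => ∑ i ∈ Finset.range a, gridIncr j i (f z) := by
      ext1 z
      exact (Finset.sum_range_sub (fun i => coord (gridTime j i) (f z)) a).symm
    rw [this]
    exact Finset.measurable_fun_sum _ fun i hi => hf j i (by grind)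
  have hgrid (j a : ℕ) (ha : a ≤ 2 * 4 ^ j) :
      Measurable fun z => coord (gridTime j a) (f z) := by
    -- Index `4 ^ j` is time `0`, where paths vanish: increments determine positions.
    have := (hdiff j a ha).sub (hdiff j (4 ^ j) (by lia))
    simpa [gridTime_center, Pi.sub_def] using this
  refine measurable_of_coord fun t => ?_
  obtain ⟨J, hJ⟩ := pow_unbounded_of_one_lt |t| (one_lt_two (α := ℝ))
  -- Index of the last grid point not exceeding `t`; the offset `J` makes every grid reach `t`.
  let a (j : ℕ) : ℕ := ⌊(t + 2 ^ (j + J)) * 2 ^ (j + J)⌋₊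
  have ht (j : ℕ) : |t| ≤ 2 ^ (j + J) :=
    hJ.le.trans (pow_le_pow_right₀ one_le_two (Nat.le_add_left _ _))
  have ha (j : ℕ) : a j ≤ 2 * 4 ^ (j + J) := by
    refine Nat.floor_le_of_le ?_
    have : (4 : ℝ) ^ (j + J) = 2 ^ (j + J) * 2 ^ (j + J) := by rw [← mul_pow]; norm_num
    push_cast
    rw [this, ← mul_assoc]
    gcongr
    linarith [le_of_abs_le (ht j)]
  have hlim : Filter.Tendsto (fun j => gridTime (j + J) (a j)) Filter.atTop (nhds t) := by
    have hmesh : Filter.Tendsto (fun j : ℕ => t - ((1 : ℝ) / 2) ^ (j + J)) Filter.atTop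
        (nhds t) := by
      simpa using tendsto_const_nhds.sub ((Filter.tendsto_add_atTop_iff_nat J).2
        (tendsto_pow_atTop_nhds_zero_of_lt_one (by norm_num : (0 : ℝ) ≤ 1 / 2) (by norm_num)))
    refine tendsto_of_tendsto_of_tendsto_of_le_of_le hmesh tendsto_const_nhds ?_ ?_
    · intro j
      have h := (Nat.lt_floor_add_one ((t + 2 ^ (j + J)) * 2 ^ (j + J) : ℝ)).le
      rw [← le_div_iff₀ (by positivity)] at h
      simp only [gridTime, a, one_div, inv_pow]
      rw [add_div, one_div] at h
      linarith
    · intro j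
      have h := Nat.floor_le (a := (t + 2 ^ (j + J)) * 2 ^ (j + J))
        (mul_nonneg (by linarith [neg_le_of_abs_le (ht j)]) (by positivity))
      rw [← div_le_iff₀ (by positivity)] at h
      simp only [gridTime, a]
      linarith
  refine measurable_of_tendsto_metrizable (fun j => hgrid (j + J) (a j) (ha j)) ?_
  exact tendsto_pi_nhds.2 fun z => ((continuous_path (f z)).tendsto t).comp hlim

end WienerSpace

/-! ### Fourier analysis of torus rotations -/

theorem UnitAddTorus.mFourier_apply_add {m : Type*} [Fintype m] (k : m → ℤ) (x y : UnitAddTorus m) :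
    mFourier k (x + y) = mFourier k x * mFourier k y := by
  simp [mFourier, fourier_apply, AddCircle.toCircle_add, smul_add, Finset.prod_mul_distrib]

theorem IsNonresonant.mFourier_ne_one {m : ℕ} {α : Fin m → ℝ} (hα : IsNonresonant α)
    {k : Fin m → ℤ} (hk : k ≠ 0) :
    UnitAddTorus.mFourier k (fun i => (α i : UnitAddCircle)) ≠ 1 := by
  have : UnitAddTorus.mFourier k (fun i => (α i : UnitAddCircle)) =
      Complex.exp ((∑ i, (k i : ℝ) * α i : ℝ) * (2 * Real.pi * Complex.I)) := by
    simp only [UnitAddTorus.mFourier, ContinuousMap.coe_mk, fourier_coe_apply, ← Complex.exp_sum]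
    push_cast
    rw [Finset.sum_mul]
    refine congrArg _ (Finset.sum_congr rfl fun i _ => ?_)
    simp
    ring
  rw [this, ne_eq, Complex.exp_eq_one_iff]
  rintro ⟨n, hn⟩
  refine hα k hk n ?_
  have := mul_right_cancel₀ Complex.two_pi_I_ne_zero hn
  exact_mod_cast this

theorem AddCircle.volume_eq_haarAddCircle :
    (volume : Measure UnitAddCircle) = AddCircle.haarAddCircle := by
  rw [AddCircle.volume_eq_smul_haarAddCircle, ENNReal.ofReal_one, one_smul]

instance : IsProbabilityMeasure (volume : Measure UnitAddCircle) := by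
  rw [AddCircle.volume_eq_haarAddCircle]; infer_instance

section Fourier

noncomputable local instance : MeasureSpace UnitAddCircle := ⟨AddCircle.haarAddCircle⟩
local instance : IsProbabilityMeasure (volume : Measure UnitAddCircle) :=
  inferInstanceAs (IsProbabilityMeasure AddCircle.haarAddCircle)

/-- The Fourier series converges to `f` in `L²`, and only its zeroth term survives. -/
theorem UnitAddTorus.ae_eq_const_of_mFourierCoeff_eq_zero {m : Type*} [Fintype m]
    {f : UnitAddTorus m → ℂ}
    (hf : MemLp f 2 (Measure.pi fun _ : m => (AddCircle.haarAddCircle : Measure UnitAddCircle)))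
    (h : ∀ k : m → ℤ, k ≠ 0 → ∫ x, mFourier (-k) x * f x
      ∂(Measure.pi fun _ : m => (AddCircle.haarAddCircle : Measure UnitAddCircle)) = 0) :
    ∃ c : ℂ, f =ᵐ[Measure.pi fun _ : m => (AddCircle.haarAddCircle : Measure UnitAddCircle)]
      fun _ => c := by
  have hsum := hasSum_mFourier_series_L2 hf.toLp
  have hcoeff (k : m → ℤ) : mFourierCoeff hf.toLp k = mFourierCoeff f k :=
    integral_congr_ae (hf.coeFn_toLp.mono fun x hx => by simp only [hx])
  have hzero (k : m → ℤ) (hk : k ≠ 0) : mFourierCoeff hf.toLp k = 0 := by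
    rw [hcoeff]; exact h k hk
  have heq : hf.toLp = mFourierCoeff hf.toLp 0 • mFourierLp 2 0 :=
    hsum.unique (hasSum_single 0 fun k hk => by rw [hzero k hk, zero_smul])
  refine ⟨mFourierCoeff hf.toLp 0, ?_⟩
  have h1 := hf.coeFn_toLp
  have h2 := Lp.coeFn_smul (mFourierCoeff hf.toLp 0) (mFourierLp 2 (0 : m → ℤ))
  rw [← heq] at h2
  filter_upwards [h1, h2, coeFn_mFourierLp 2 (0 : m → ℤ)] with x hx1 hx2 hx3
  rw [← hx1, hx2, Pi.smul_apply, hx3, mFourier_zero]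
  simp

end Fourier

/-- A square-integrable function on the torus that is invariant under a non-resonant rotation is
almost everywhere constant. -/
theorem IsNonresonant.ae_eq_const_of_invariant {m : ℕ} {α : Fin m → ℝ} (hα : IsNonresonant α)
    {f : UnitAddTorus (Fin m) → ℂ} (hf : MemLp f 2 volume)
    (hinv : ∀ x, f (x + fun i => (α i : UnitAddCircle)) = f x) :
    ∃ c : ℂ, f =ᵐ[volume] fun _ => c := by
  have hvol : (volume : Measure (UnitAddTorus (Fin m))) =
      Measure.pi fun _ => (AddCircle.haarAddCircle : Measure UnitAddCircle) := by
    rw [volume_pi]; simp only [AddCircle.volume_eq_haarAddCircle]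
  rw [hvol] at hf ⊢
  refine UnitAddTorus.ae_eq_const_of_mFourierCoeff_eq_zero hf fun k hk => ?_
  rw [← hvol]
  -- Translating by `α` multiplies the coefficient by a character value different from `1`, yet
  -- leaves it unchanged, so it is zero.
  have h := integral_add_right_eq_self (μ := (volume : Measure (UnitAddTorus (Fin m))))
    (fun x => UnitAddTorus.mFourier (-k) x * f x) (fun i => (α i : UnitAddCircle))
  simp only [UnitAddTorus.mFourier_apply_add, hinv] at h
  simp only [mul_right_comm _ _ (f _), integral_mul_const] at h
  have hne := hα.mFourier_ne_one (neg_ne_zero.2 hk)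
  by_contra h0
  exact hne (mul_left_cancel₀ h0 (h.trans (mul_one _).symm))

/-! ### Blocks of increments under Wiener measure -/

namespace WienerSpace

variable {d : ℕ}

/-- The vector of `2 * 4 ^ j` consecutive increments along the grid of mesh `2⁻ʲ`, starting with the
`a`-th one. -/
noncomputable def block (j a : ℕ) (ω : WienerSpace d) :
    Fin (2 * 4 ^ j) → EuclideanSpace ℝ (Fin d) := fun i => gridIncr j (i + a) ω

theorem measurable_block (j a : ℕ) : Measurable (block j a : WienerSpace d → _) :=
  measurable_pi_lambda _ fun i => measurable_gridIncr j (i + a)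

theorem block_shift (j a n : ℕ) (ω : WienerSpace d) :
    block j a (shift n ω) = block j (a + n * 2 ^ j) ω := by
  ext1 i
  simp only [block, gridIncr_shift, add_assoc]

theorem measurable_of_block {Z : Type*} [MeasurableSpace Z] {f : Z → WienerSpace d}
    (hf : ∀ j, Measurable fun z => block j 0 (f z)) : Measurable f :=
  measurable_of_gridIncr fun j i hi => measurable_pi_iff.1 (hf j) ⟨i, hi⟩

/-- Coarse increments are sums of two finer ones, and the finer window is larger: the block
σ-algebras increase with the level. -/
theorem measurable_block_of_le {Z : Type*} [MeasurableSpace Z] {f : Z → WienerSpace d} {j k : ℕ}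
    (hjk : j ≤ k) (hf : Measurable fun z => block k 0 (f z)) :
    Measurable fun z => block j 0 (f z) := by
  induction k, hjk using Nat.le_induction with
  | base => exact hf
  | succ k _ ih =>
    refine ih (measurable_pi_lambda _ fun i => ?_)
    have hi := i.2
    have hi' : 2 * (i : ℕ) + 2 * 4 ^ k + 1 < 2 * 4 ^ (k + 1) := by rw [pow_succ]; lia
    have h1 := measurable_pi_iff.1 hf ⟨2 * i + 2 * 4 ^ k, by lia⟩
    have h2 := measurable_pi_iff.1 hf ⟨2 * i + 2 * 4 ^ k + 1, hi'⟩
    have heq : (fun z => block k 0 (f z) i) = fun z =>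
        block (k + 1) 0 (f z) ⟨2 * i + 2 * 4 ^ k, by lia⟩ +
          block (k + 1) 0 (f z) ⟨2 * i + 2 * 4 ^ k + 1, hi'⟩ :=
      funext fun z => gridIncr_refine k i (f z)
    rw [heq]
    exact h1.add h2

namespace IsWienerMeasure

variable {P : Measure (WienerSpace d)}

theorem iIndepFun_gridIncr (hP : IsWienerMeasure P) (j : ℕ) :
    iIndepFun (fun i => (gridIncr j i : WienerSpace d → _)) P :=
  hP.hasIndepIncrements.nat (monotone_gridTime j)

theorem map_gridIncr (hP : IsWienerMeasure P) (j i : ℕ) :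
    P.map (gridIncr j i) = (stdGaussian (EuclideanSpace ℝ (Fin d))).map
      (fun x => Real.sqrt (1 / 2 ^ j) • x) := by
  rw [← gridTime_succ_sub j i]
  exact hP.map_increment _ _ (monotone_gridTime j i.le_succ)

/-- Stationarity: either law is the product of the same Gaussian laws, all cells having equal
length. -/
theorem map_block (hP : IsWienerMeasure P) (j a : ℕ) :
    P.map (block j a) = P.map (block j 0) := by
  have h (b : ℕ) : P.map (block j b) = Measure.pi fun _ : Fin (2 * 4 ^ j) =>
      (stdGaussian (EuclideanSpace ℝ (Fin d))).map (fun x => Real.sqrt (1 / 2 ^ j) • x) := by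
    have hind : iIndepFun (fun i : Fin (2 * 4 ^ j) =>
        (gridIncr j (i + b) : WienerSpace d → _)) P :=
      (hP.iIndepFun_gridIncr j).precomp (g := fun i : Fin (2 * 4 ^ j) => (i : ℕ) + b)
        fun x y hxy => Fin.ext (Nat.add_right_cancel hxy)
    have := hind.map_fun_eq_pi_map
      fun i : Fin (2 * 4 ^ j) => (measurable_gridIncr j (i + b)).aemeasurable
    simp only [hP.map_gridIncr] at this
    exact this
  rw [h, h]

theorem indepFun_block (hP : IsWienerMeasure P) {j a : ℕ} (ha : 2 * 4 ^ j ≤ a) :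
    IndepFun (block j 0) (block j a) P := by
  have h := (hP.iIndepFun_gridIncr j).indepFun_finset (Finset.range (2 * 4 ^ j))
    (Finset.Ico a (2 * 4 ^ j + a))
    (Finset.disjoint_left.2 fun x hx hx' => by grind) (measurable_gridIncr j)
  exact h.comp
    (φ := fun (g : Finset.range (2 * 4 ^ j) → EuclideanSpace ℝ (Fin d)) (i : Fin (2 * 4 ^ j)) =>
      g ⟨i, by simp⟩)
    (ψ := fun (g : Finset.Ico a (2 * 4 ^ j + a) → EuclideanSpace ℝ (Fin d))
      (i : Fin (2 * 4 ^ j)) => g ⟨i + a, by simp⟩)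
    (measurable_pi_lambda _ fun i => measurable_pi_apply _)
    (measurable_pi_lambda _ fun i => measurable_pi_apply _)

/-- The Wiener shift preserves Wiener measure. -/
theorem measurePreserving_shift_one (hP : IsWienerMeasure P) :
    MeasurePreserving (shift 1) P P := by
  have := hP.isProbabilityMeasure
  let C : Set (Set (WienerSpace d)) :=
    {s | ∃ j, MeasurableSet[MeasurableSpace.comap (block j 0) inferInstance] s}
  have hmono {j k : ℕ} (hjk : j ≤ k) :
      MeasurableSpace.comap (block j 0 : WienerSpace d → _) inferInstance ≤
        MeasurableSpace.comap (block k 0) inferInstance := by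
    let _ : MeasurableSpace (WienerSpace d) := MeasurableSpace.comap (block k 0) inferInstance
    exact (measurable_block_of_le (f := id) hjk (comap_measurable _)).comap_le
  refine ⟨measurable_shift 1, ext_of_generate_finite C ?_ ?_ ?_ ?_⟩
  · refine le_antisymm ?_ (MeasurableSpace.generateFrom_le ?_)
    · have : @Measurable _ _ (MeasurableSpace.generateFrom C) _
          (id : WienerSpace d → WienerSpace d) := by
        refine @measurable_of_block _ _ (MeasurableSpace.generateFrom C) _ fun j s hs => ?_
        exact MeasurableSpace.measurableSet_generateFrom ⟨j, s, hs, rfl⟩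
      exact fun s hs => this hs
    · rintro s ⟨j, hs⟩
      exact (measurable_block j 0).comap_le _ hs
  · rintro s ⟨j, hs⟩ t ⟨k, ht⟩ -
    exact ⟨max j k, MeasurableSet.inter (hmono (le_max_left j k) _ hs)
      (hmono (le_max_right j k) _ ht)⟩
  · rintro s ⟨j, B, hB, rfl⟩
    rw [Measure.map_apply (measurable_shift 1) (measurable_block j 0 hB)]
    -- One unit of time is `2 ^ j` grid cells.
    have : shift 1 ⁻¹' (block j 0 ⁻¹' B) = (block j (2 ^ j) : WienerSpace d → _) ⁻¹' B := by
      ext ω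
      have := block_shift j 0 1 ω
      simp only [Nat.cast_one, zero_add, one_mul] at this
      simp only [Set.mem_preimage, this]
    rw [this, ← Measure.map_apply (measurable_block j _) hB, hP.map_block,
      Measure.map_apply (measurable_block j _) hB]
  · rw [Measure.map_apply (measurable_shift 1) MeasurableSet.univ, Set.preimage_univ]

end IsWienerMeasure

/-- The sets which depend measurably on a parameter and on finitely many dyadic increments of the
path. -/
def blockSets (Z : Type*) [MeasurableSpace Z] (d : ℕ) : Set (Set (Z × WienerSpace d)) :=
  {s | ∃ j, MeasurableSet[MeasurableSpace.comap (Prod.map id (block j 0)) inferInstance] s}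

theorem measurable_of_map_block {W Z : Type*} [MeasurableSpace W] [MeasurableSpace Z]
    {f : W → Z × WienerSpace d} (hf : ∀ j, Measurable fun w => Prod.map id (block j 0) (f w)) :
    Measurable f :=
  Measurable.prodMk (hf 0).fst (measurable_of_block fun j => (hf j).snd)

theorem measurable_map_block_of_le {W Z : Type*} [MeasurableSpace W] [MeasurableSpace Z]
    {f : W → Z × WienerSpace d} {j k : ℕ} (hjk : j ≤ k)
    (hf : Measurable fun w => Prod.map id (block k 0) (f w)) :
    Measurable fun w => Prod.map id (block j 0) (f w) :=
  Measurable.prodMk hf.fst (measurable_block_of_le hjk hf.snd)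

theorem comap_map_block_mono (Z : Type*) [MeasurableSpace Z] {j k : ℕ} (hjk : j ≤ k) :
    MeasurableSpace.comap (Prod.map id (block j 0) : Z × WienerSpace d → _) inferInstance ≤
      MeasurableSpace.comap (Prod.map id (block k 0)) inferInstance :=
  @Measurable.comap_le _ _ (_) _ _ <| @measurable_map_block_of_le d _ Z
    (MeasurableSpace.comap (Prod.map id (block k 0)) inferInstance) _ id j k hjk
    (comap_measurable _)

/-- A generating ring approximates every measurable set in measure. -/
theorem isSetRing_blockSets (Z : Type*) [MeasurableSpace Z] : IsSetRing (blockSets Z d) where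
  empty_mem := ⟨0, @MeasurableSet.empty _ (_)⟩
  union_mem := by
    rintro s t ⟨j, hs⟩ ⟨k, ht⟩
    exact ⟨max j k, MeasurableSet.union (comap_map_block_mono Z (le_max_left j k) _ hs)
      (comap_map_block_mono Z (le_max_right j k) _ ht)⟩
  sdiff_mem := by
    rintro s t ⟨j, hs⟩ ⟨k, ht⟩
    exact ⟨max j k, MeasurableSet.diff (comap_map_block_mono Z (le_max_left j k) _ hs)
      (comap_map_block_mono Z (le_max_right j k) _ ht)⟩

theorem generateFrom_blockSets (Z : Type*) [MeasurableSpace Z] :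
    (Prod.instMeasurableSpace : MeasurableSpace (Z × WienerSpace d)) =
      MeasurableSpace.generateFrom (blockSets Z d) := by
  refine le_antisymm ?_ (MeasurableSpace.generateFrom_le ?_)
  · have : @Measurable _ _ (MeasurableSpace.generateFrom (blockSets Z d)) _
        (id : Z × WienerSpace d → Z × WienerSpace d) :=
      @measurable_of_map_block d _ Z (MeasurableSpace.generateFrom (blockSets Z d)) _ id
        fun j s hs => MeasurableSpace.measurableSet_generateFrom ⟨j, s, hs, rfl⟩
    exact fun s hs => this hs
  · rintro s ⟨j, hs⟩
    exact (measurable_id.prodMap (measurable_block j 0)).comap_le _ hs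

end WienerSpace

/-! ### Measures of sections -/

section Sections

variable {Z Ω : Type*} [MeasurableSpace Z] [MeasurableSpace Ω] {ν : Measure Z} {P : Measure Ω}
  [IsProbabilityMeasure P] {S : Set (Z × Ω)}

theorem measurable_measureReal_prodMk_left (hS : MeasurableSet S) :
    Measurable fun z => P.real (Prod.mk z ⁻¹' S) :=
  (measurable_measure_prodMk_left hS).ennreal_toReal

theorem integrable_measureReal_prodMk_left [IsFiniteMeasure ν] (hS : MeasurableSet S) :
    Integrable (fun z => P.real (Prod.mk z ⁻¹' S)) ν :=
  Integrable.of_bound (measurable_measureReal_prodMk_left hS).aestronglyMeasurable 1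
    (.of_forall fun z => by
      rw [Real.norm_of_nonneg measureReal_nonneg]; exact measureReal_le_one)

theorem integral_measureReal_prodMk_left [SFinite ν] (hS : MeasurableSet S) :
    ∫ z, P.real (Prod.mk z ⁻¹' S) ∂ν = (ν.prod P).real S := by
  rw [measureReal_def, Measure.prod_apply hS]
  exact integral_toReal (measurable_measure_prodMk_left hS).aemeasurable
    (.of_forall fun z => measure_lt_top _ _)

end Sections

/-! ### Decoupling and approximation for the product map -/

section RotationShift

open WienerSpace

variable {m d : ℕ} {α : Fin m → ℝ} {P : Measure (WienerSpace d)}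

theorem measurePreserving_rotationShift (hP : IsWienerMeasure P) (α : Fin m → ℝ) :
    MeasurePreserving (rotationShift α : UnitAddTorus (Fin m) × WienerSpace d → _)
      (volume.prod P) (volume.prod P) := by
  have := hP.isProbabilityMeasure
  exact (measurePreserving_add_right (volume : Measure (UnitAddTorus (Fin m)))
    (fun i => (α i : UnitAddCircle))).prod hP.measurePreserving_shift_one

theorem iterate_rotationShift (α : Fin m → ℝ) (n : ℕ)
    (p : UnitAddTorus (Fin m) × WienerSpace d) :
    (rotationShift α)^[n] p =
      (p.1 + n • (fun i => (α i : UnitAddCircle)), WienerSpace.shift n p.2) := by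
  have : (rotationShift α : UnitAddTorus (Fin m) × WienerSpace d → _) =
      Prod.map (· + fun i => (α i : UnitAddCircle)) (WienerSpace.shift 1) := rfl
  rw [this, Prod.map_iterate, iterate_shift_one, add_right_iterate]
  rfl

/-- Block sets decouple exactly from their remote preimages, conditionally on the torus
coordinate. -/
theorem WienerSpace.exists_measureReal_inter_preimage_iterate (hP : IsWienerMeasure P)
    (α : Fin m → ℝ) {S : Set (UnitAddTorus (Fin m) × WienerSpace d)}
    (hS : S ∈ blockSets (UnitAddTorus (Fin m)) d) :
    ∃ n : ℕ, (volume.prod P).real (S ∩ (rotationShift α)^[n] ⁻¹' S) =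
      ∫ θ, P.real (Prod.mk θ ⁻¹' S) *
        P.real (Prod.mk (θ + n • fun i => (α i : UnitAddCircle)) ⁻¹' S) := by
  have := hP.isProbabilityMeasure
  obtain ⟨j, B, hB, rfl⟩ := hS
  have hSm : MeasurableSet (Prod.map id (block j 0) ⁻¹' B :
      Set (UnitAddTorus (Fin m) × WienerSpace d)) :=
    (measurable_id.prodMap (measurable_block j 0)) hB
  -- The length of the window `[-2 ^ j, 2 ^ j]`: the shifted window is adjacent to it and shares no
  -- increment.
  refine ⟨2 * 2 ^ j, ?_⟩
  rw [← integral_measureReal_prodMk_left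
    (hSm.inter (((measurePreserving_rotationShift hP α).iterate _).measurable hSm))]
  refine integral_congr_ae (.of_forall fun θ => ?_)
  have hn : 2 * 2 ^ j * 2 ^ j = 2 * 4 ^ j := by rw [mul_assoc, ← mul_pow]; norm_num
  set β : UnitAddTorus (Fin m) := (2 * 2 ^ j) • fun i => (α i : UnitAddCircle)
  have hB' (x : UnitAddTorus (Fin m)) : MeasurableSet (Prod.mk x ⁻¹' B) :=
    measurable_prodMk_left hB
  have hsec : Prod.mk θ ⁻¹' (Prod.map id (block j 0) ⁻¹' B ∩
      (rotationShift α)^[2 * 2 ^ j] ⁻¹' (Prod.map id (block j 0) ⁻¹' B)) =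
      (block j 0 : WienerSpace d → _) ⁻¹' (Prod.mk θ ⁻¹' B) ∩
        block j (2 * 4 ^ j) ⁻¹' (Prod.mk (θ + β) ⁻¹' B) := by
    ext ω
    simp only [Set.mem_preimage, Set.mem_inter_iff, iterate_rotationShift, Prod.map_apply, id,
      block_shift, zero_add, hn]
    rfl
  have hlaw : P (block j (2 * 4 ^ j) ⁻¹' (Prod.mk (θ + β) ⁻¹' B)) =
      P (block j 0 ⁻¹' (Prod.mk (θ + β) ⁻¹' B)) := by
    rw [← Measure.map_apply (measurable_block j _) (hB' _), hP.map_block,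
      Measure.map_apply (measurable_block j _) (hB' _)]
  simp only [measureReal_def]
  rw [hsec, (hP.indepFun_block le_rfl).measure_inter_preimage_eq_mul _ _ (hB' _) (hB' _), hlaw,
    ENNReal.toReal_mul]
  rfl

theorem measureReal_section_ae_eq (hα : IsNonresonant α) (hP : IsWienerMeasure P)
    {S : Set (UnitAddTorus (Fin m) × WienerSpace d)} (hS : MeasurableSet S)
    (hinv : rotationShift α ⁻¹' S = S) :
    ∀ᵐ θ : UnitAddTorus (Fin m), P.real (Prod.mk θ ⁻¹' S) = (volume.prod P).real S := by
  have := hP.isProbabilityMeasure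
  have hp := integrable_measureReal_prodMk_left (ν := (volume : Measure (UnitAddTorus (Fin m))))
    (P := P) hS
  -- By invariance of `S`, its section at `θ` is the shift preimage of its section at `θ + α`, and
  -- the shift preserves `P`.
  have hrot (θ : UnitAddTorus (Fin m)) :
      P.real (Prod.mk (θ + fun i => (α i : UnitAddCircle)) ⁻¹' S) = P.real (Prod.mk θ ⁻¹' S) := by
    rw [measureReal_def, ← hP.measurePreserving_shift_one.measure_preimage
      (measurable_prodMk_left hS).nullMeasurableSet, measureReal_def]
    conv_rhs => rw [← hinv]
    rfl
  have hLp : MemLp (fun θ : UnitAddTorus (Fin m) => (P.real (Prod.mk θ ⁻¹' S) : ℂ)) 2 volume :=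
    MemLp.of_bound hp.ofReal.aestronglyMeasurable 1 (.of_forall fun θ => by
      rw [Complex.norm_real, Real.norm_of_nonneg measureReal_nonneg]; exact measureReal_le_one)
  obtain ⟨c, hc⟩ := hα.ae_eq_const_of_invariant hLp fun θ => by rw [hrot]
  have hre : ∀ᵐ θ : UnitAddTorus (Fin m), P.real (Prod.mk θ ⁻¹' S) = c.re := by
    filter_upwards [hc] with θ hθ
    rw [← hθ, Complex.ofReal_re]
  have hint := integral_congr_ae hre
  rw [integral_measureReal_prodMk_left hS] at hint
  simp only [integral_const, probReal_univ, one_smul] at hint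
  filter_upwards [hre] with θ hθ
  rw [hθ, hint]

/-- Both `c` and `c ^ 2` are within twice the approximation error of the measure of `S' ∩ T ⁻¹' S'`:
the first by invariance of `S`, the second by decoupling. -/
theorem abs_measureReal_sub_sq_le (hα : IsNonresonant α) (hP : IsWienerMeasure P)
    {S S' : Set (UnitAddTorus (Fin m) × WienerSpace d)} (hS : MeasurableSet S)
    (hinv : rotationShift α ⁻¹' S = S) (hS' : S' ∈ blockSets (UnitAddTorus (Fin m)) d) :
    |(volume.prod P).real S - (volume.prod P).real S ^ 2| ≤
      4 * (volume.prod P).real (symmDiff S' S) := by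
  have := hP.isProbabilityMeasure
  have hSm' : MeasurableSet S' := by
    rw [generateFrom_blockSets]; exact MeasurableSpace.measurableSet_generateFrom hS'
  obtain ⟨n, hn⟩ := exists_measureReal_inter_preimage_iterate hP α hS'
  have hT := (measurePreserving_rotationShift hP α).iterate n
  have hinvn : (rotationShift α)^[n] ⁻¹' S = S := by
    rw [Set.preimage_iterate_eq]
    exact Function.iterate_fixed hinv n
  set μ := (volume : Measure (UnitAddTorus (Fin m))).prod P
  set β : UnitAddTorus (Fin m) := n • fun i => (α i : UnitAddCircle)
  set c := μ.real S
  set T : UnitAddTorus (Fin m) × WienerSpace d → _ := (rotationShift α)^[n]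
  set q : UnitAddTorus (Fin m) → ℝ := fun θ => P.real (Prod.mk θ ⁻¹' S')
  have hq : Integrable q := integrable_measureReal_prodMk_left hSm'
  -- Almost every section of `S` has measure `c`, so `|q θ - c|` is at most the measure of the
  -- section of `symmDiff S' S`.
  have hqc : ∫ θ, |q θ - c| ≤ μ.real (symmDiff S' S) := by
    rw [← integral_measureReal_prodMk_left (hSm'.symmDiff hS)]
    refine integral_mono_ae (hq.sub (integrable_const c)).abs
      (integrable_measureReal_prodMk_left (hSm'.symmDiff hS)) ?_
    filter_upwards [measureReal_section_ae_eq hα hP hS hinv] with θ hθ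
    rw [show c = P.real (Prod.mk θ ⁻¹' S) from hθ.symm]
    exact abs_measureReal_sub_le_measureReal_symmDiff
      (measurable_prodMk_left hSm').nullMeasurableSet (measurable_prodMk_left hS).nullMeasurableSet
  have hqβ : Integrable (fun θ => |q (θ + β) - c|) :=
    ((hq.comp_add_right β).sub (integrable_const c)).abs
  have hqβc : ∫ θ, |q (θ + β) - c| ≤ μ.real (symmDiff S' S) :=
    (integral_add_right_eq_self (fun θ => |q θ - c|) β).trans_le hqc
  have hc0 : 0 ≤ c := measureReal_nonneg
  have hc1 : c ≤ 1 := measureReal_le_one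
  have hq0 (θ) : 0 ≤ q θ := measureReal_nonneg
  have hq1 (θ) : q θ ≤ 1 := measureReal_le_one
  have hqq : Integrable (fun θ => q θ * q (θ + β)) :=
    (hq.comp_add_right β).bdd_mul (c := 1) hq.aestronglyMeasurable (.of_forall fun θ => by
      rw [Real.norm_of_nonneg (hq0 θ)]; exact hq1 θ)
  have hcorr : |μ.real (S' ∩ T ⁻¹' S') - c ^ 2| ≤ 2 * μ.real (symmDiff S' S) := by
    have hsub : μ.real (S' ∩ T ⁻¹' S') - c ^ 2 = ∫ θ, (q θ * q (θ + β) - c ^ 2) := by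
      rw [integral_sub hqq (integrable_const _), hn]
      simp [q]
    calc |μ.real (S' ∩ T ⁻¹' S') - c ^ 2|
        ≤ ∫ θ, |q θ * q (θ + β) - c ^ 2| := by rw [hsub]; exact abs_integral_le_integral_abs
      _ ≤ ∫ θ, (|q θ - c| + |q (θ + β) - c|) := by
          refine integral_mono (hqq.sub (integrable_const _)).abs
            ((hq.sub (integrable_const c)).abs.add hqβ) fun θ => ?_
          calc |q θ * q (θ + β) - c ^ 2| = |(q θ - c) * c + q θ * (q (θ + β) - c)| := by ring_nf
            _ ≤ |q θ - c| * c + q θ * |q (θ + β) - c| := by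
              refine (abs_add_le _ _).trans_eq ?_
              rw [abs_mul, abs_mul, abs_of_nonneg hc0, abs_of_nonneg (hq0 θ)]
            _ ≤ |q θ - c| + |q (θ + β) - c| := add_le_add
              (mul_le_of_le_one_right (abs_nonneg _) hc1)
              (mul_le_of_le_one_left (abs_nonneg _) (hq1 θ))
      _ = (∫ θ, |q θ - c|) + ∫ θ, |q (θ + β) - c| :=
          integral_add (hq.sub (integrable_const c)).abs hqβ
      _ ≤ 2 * μ.real (symmDiff S' S) := by linarith
  have hself : |c - μ.real (S' ∩ T ⁻¹' S')| ≤ 2 * μ.real (symmDiff S' S) := by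
    have hpre : μ.real (T ⁻¹' symmDiff S' S) = μ.real (symmDiff S' S) :=
      hT.measureReal_preimage (hSm'.symmDiff hS).nullMeasurableSet
    have hincl : symmDiff S (S' ∩ T ⁻¹' S') ⊆ symmDiff S' S ∪ T ⁻¹' symmDiff S' S := by
      intro x hx
      have hxT : T x ∈ S ↔ x ∈ S := by
        conv_rhs => rw [← hinvn]
        rfl
      simp only [Set.mem_symmDiff, Set.mem_union, Set.mem_preimage, Set.mem_inter_iff] at hx ⊢
      tauto
    calc |c - μ.real (S' ∩ T ⁻¹' S')| ≤ μ.real (symmDiff S (S' ∩ T ⁻¹' S')) :=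
          abs_measureReal_sub_le_measureReal_symmDiff hS.nullMeasurableSet
            (hSm'.inter (hT.measurable hSm')).nullMeasurableSet
      _ ≤ μ.real (symmDiff S' S) + μ.real (T ⁻¹' symmDiff S' S) :=
          (measureReal_mono hincl).trans (measureReal_union_le _ _)
      _ = 2 * μ.real (symmDiff S' S) := by rw [hpre]; ring
  calc |c - c ^ 2| ≤ |c - μ.real (S' ∩ T ⁻¹' S')| + |μ.real (S' ∩ T ⁻¹' S') - c ^ 2| :=
        abs_sub_le _ _ _
    _ ≤ 4 * μ.real (symmDiff S' S) := by linarith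

end RotationShift

theorem mainTheorem7 (m d : ℕ) (α : Fin m → ℝ) (hα : IsNonresonant α)
    (P : Measure (WienerSpace d)) (hP : WienerSpace.IsWienerMeasure P) :
    Ergodic (rotationShift α : UnitAddTorus (Fin m) × WienerSpace d → _)
      ((volume : Measure (UnitAddTorus (Fin m))).prod P) := by
  have := hP.isProbabilityMeasure
  refine ⟨measurePreserving_rotationShift hP α, ⟨fun S hS hinv => ?_⟩⟩
  set μ := (volume : Measure (UnitAddTorus (Fin m))).prod P
  -- Block sets approximate `S` arbitrarily well, which forces `μ.real S` to be `0` or `1`.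
  have hle (ε : ℝ) (hε : 0 < ε) : |μ.real S - μ.real S ^ 2| ≤ 4 * ε := by
    obtain ⟨S', hS', hlt⟩ := exists_measure_symmDiff_lt_of_generateFrom_isSetRing (μ := μ)
      (WienerSpace.isSetRing_blockSets (UnitAddTorus (Fin m)))
      ⟨{Set.univ}, Set.countable_singleton _, Set.singleton_subset_iff.2 ⟨0, MeasurableSet.univ⟩,
        by simp⟩
      (WienerSpace.generateFrom_blockSets (UnitAddTorus (Fin m))) hS (ENNReal.ofReal_pos.2 hε)
    refine (abs_measureReal_sub_sq_le hα hP hS hinv hS').trans ?_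
    have : μ.real (symmDiff S' S) ≤ ε := ENNReal.toReal_le_of_le_ofReal hε.le hlt.le
    gcongr
  have hsq : μ.real S - μ.real S ^ 2 = 0 := by
    refine abs_eq_zero.1 (le_antisymm (le_of_forall_pos_le_add fun ε hε => ?_) (abs_nonneg _))
    linarith [hle (ε / 4) (by positivity)]
  rw [Filter.eventuallyConst_set']
  rcases mul_eq_zero.1 (show μ.real S * (1 - μ.real S) = 0 by linarith) with h | h
  · exact Or.inl (ae_eq_empty.2 ((measureReal_eq_zero_iff).1 h))
  · refine Or.inr (ae_eq_univ.2 ?_)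
    rw [← measureReal_eq_zero_iff, probReal_compl_eq_one_sub hS, h]
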